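/- Let $R$ be a commutative ring with identity. A submodule $F$ of an $R$-module $E$ is *pure* if the sequence $0\to F\to E\to E/F\to 0$ remains exact after tensoring with any $R$-module, and it is an *RD-submodule* if $rE\cap F=rF$ for every $r\in R$. A *pure-composition series* (respectively an *RD-composition series*) of an $R$-module $M$ is a finite chain $\{0\}=M_0\subset M_1\subset\dots\subset M_n=M$ of pure submodules (respectively RD-submodules) of $M$; its factors are the modules $M_i/M_{i-1}$, $1\le i\le n$. The following conditions are equivalent: 1. Every finitely generated $R$-module has a pure-composition series with cyclic factors. 2. Every finitely generated $R$-module has an RD-composition series with cyclic factors. Moreover, if $R$ satisfies one of these conditions, then $R$ is arithmetic, i.e. for every maximal ideal $P$ the ideals of the localization $R_P$ are totally ordered by inclusion, and $R$ is a Kaplansky ring (elementary divisor ring), i.e. every finitely presented $R$-module is isomorphic to a finite direct sum of modules of the form $R/Ra$ with $a\in R$. -/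

import Mathlib

open scoped Pointwise

universe u

/-- `F` is a pure submodule of `E`: the sequence `0 → F → E → E ⧸ F → 0` stays exact after
tensoring with any `R`-module. -/
def IsPureSubmodule {R : Type u} [CommRing R] {E : Type u} [AddCommGroup E] [Module R E]
    (F : Submodule R E) : Prop :=
  ∀ (N : Type u) [AddCommGroup N] [Module R N],
    Function.Injective (F.subtype.rTensor N) ∧
    Function.Exact (F.subtype.rTensor N) (F.mkQ.rTensor N) ∧
    Function.Surjective (F.mkQ.rTensor N)

/-- `F` is an RD-submodule (relatively divisible submodule) of `E`: `rE ∩ F = rF` for every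
`r ∈ R`. -/
def IsRDSubmodule {R : Type u} [CommRing R] {E : Type u} [AddCommGroup E] [Module R E]
    (F : Submodule R E) : Prop :=
  ∀ r : R, (r • (⊤ : Submodule R E)) ⊓ F = r • F

/-- `E` is a cyclic module: it is generated by one element. -/
def IsCyclicModule (R : Type u) [CommRing R] (E : Type u) [AddCommGroup E] [Module R E] : Prop :=
  ∃ x : E, Submodule.span R {x} = ⊤

/-- There is a finite chain `0 = M₀ ⊂ M₁ ⊂ ⋯ ⊂ Mₙ = M` of submodules of `M` that satisfy `P`,
all of whose factors `Mᵢ₊₁ ⧸ Mᵢ` are cyclic. -/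
def HasCyclicSeries {R : Type u} [CommRing R] {M : Type u} [AddCommGroup M] [Module R M]
    (P : Submodule R M → Prop) : Prop :=
  ∃ (n : ℕ) (c : Fin (n + 1) → Submodule R M),
    StrictMono c ∧ c 0 = ⊥ ∧ c (Fin.last n) = ⊤ ∧ (∀ i, P (c i)) ∧
    ∀ i : Fin n,
      IsCyclicModule R (↥(c i.succ) ⧸ (c i.castSucc).submoduleOf (c i.succ))

/-- Every finitely generated `R`-module has a pure-composition series with cyclic factors. -/
def HasPureCyclicSeriesProperty (R : Type u) [CommRing R] : Prop :=
  ∀ (M : Type u) [AddCommGroup M] [Module R M], Module.Finite R M →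
    HasCyclicSeries (fun F : Submodule R M => IsPureSubmodule F)

/-- Every finitely generated `R`-module has an RD-composition series with cyclic factors. -/
def HasRDCyclicSeriesProperty (R : Type u) [CommRing R] : Prop :=
  ∀ (M : Type u) [AddCommGroup M] [Module R M], Module.Finite R M →
    HasCyclicSeries (fun F : Submodule R M => IsRDSubmodule F)

/-- The submodules of `E` are totally ordered by inclusion. -/
def IsUniserial (R : Type u) [CommRing R] (E : Type u) [AddCommGroup E] [Module R E] : Prop :=
  ∀ A B : Submodule R E, A ≤ B ∨ B ≤ A

/-- A valuation ring, possibly with zero divisors: a ring that is uniserial as a module over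
itself. (Mathlib's `ValuationRing` is restricted to domains.) -/
def IsUniserialRing (R : Type u) [CommRing R] : Prop :=
  IsUniserial R R

/-- `R` is arithmetic: its localization at every maximal ideal is a valuation ring. -/
def IsArithmeticRing (R : Type u) [CommRing R] : Prop :=
  ∀ (P : Ideal R) [P.IsMaximal], IsUniserialRing (Localization.AtPrime P)

/-- `R` is a Kaplansky ring (elementary divisor ring): every finitely presented `R`-module is a
finite direct sum of cyclically presented modules `R ⧸ Ra`. -/
def IsKaplanskyRing (R : Type u) [CommRing R] : Prop :=
  ∀ (M : Type u) [AddCommGroup M] [Module R M], Module.FinitePresentation R M →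
    ∃ (n : ℕ) (a : Fin n → R), Nonempty (M ≃ₗ[R] ((i : Fin n) → R ⧸ Ideal.span {a i}))

open scoped TensorProduct

/-! Everything passes through comparability of ring elements at each maximal ideal. Purity always
implies relative divisibility. The RD series property forces local comparability
(`HasRDCyclicSeriesProperty.isLocallyComparable`), and then Gaussian elimination with a pivot of
least divisibility solves linear systems inside an RD-submodule locally, hence globally, so
RD-submodules are pure (`IsRDSubmodule.isPureSubmodule`). This gives the equivalence, and
arithmeticity is local comparability read in the localizations. For the Kaplansky property, a series
of a finitely generated ideal can be collapsed to one generator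
(`HasRDCyclicSeriesProperty.isPrincipal_of_fg`). Hence a finitely presented cyclic factor is some `R
⧸ Ra`; relative divisibility lifts its generator to an element killed by `a`, so a finitely
presented module splits along its series from the top down. -/

/-- Any two elements of `R` are comparable for divisibility locally at every maximal ideal. -/
def IsLocallyComparable (R : Type u) [CommRing R] : Prop :=
  ∀ P : Ideal R, P.IsMaximal → ∀ a b : R, ∃ s ∉ P, b ∣ s * a ∨ a ∣ s * b

/-! ### Relative divisibility, and purity implies it -/

section RD

variable {R : Type u} [CommRing R] {E : Type u} [AddCommGroup E] [Module R E]

theorem isRDSubmodule_iff {F : Submodule R E} :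
    IsRDSubmodule F ↔ ∀ (r : R) (m : E), r • m ∈ F → ∃ f ∈ F, r • f = r • m := by
  constructor
  · intro h r m hm
    have : r • m ∈ (r • (⊤ : Submodule R E)) ⊓ F :=
      ⟨Submodule.smul_mem_pointwise_smul _ _ _ trivial, hm⟩
    rw [h r] at this
    exact (Submodule.mem_smul_pointwise_iff_exists _ _ _).1 this
  · intro h r
    ext x
    simp only [Submodule.mem_inf, Submodule.mem_smul_pointwise_iff_exists]
    constructor
    · rintro ⟨⟨m, -, rfl⟩, hm⟩
      exact h r m hm
    · rintro ⟨f, hf, rfl⟩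
      exact ⟨⟨f, trivial, rfl⟩, F.smul_mem r hf⟩

/-- Tensoring with `R ⧸ Rr` suffices, since it sends `F` to `F ⧸ rF`. -/
theorem IsPureSubmodule.isRDSubmodule {F : Submodule R E} (h : IsPureSubmodule F) :
    IsRDSubmodule F := by
  rw [isRDSubmodule_iff]
  intro r m hm
  have hinj := (h (R ⧸ Ideal.span {r})).1
  have hr : (Ideal.Quotient.mk (Ideal.span {r}) r) = 0 :=
    Ideal.Quotient.eq_zero_iff_mem.2 (Ideal.mem_span_singleton_self r)
  have hzero : (⟨r • m, hm⟩ : F) ⊗ₜ[R] (1 : R ⧸ Ideal.span {r}) = 0 := by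
    apply hinj
    rw [LinearMap.rTensor_tmul, map_zero, Submodule.subtype_apply, TensorProduct.smul_tmul,
      Algebra.smul_def, mul_one, Ideal.Quotient.algebraMap_eq, hr, TensorProduct.tmul_zero]
  have hq := congrArg (TensorProduct.quotTensorEquivQuotSMul F (Ideal.span {r}))
    (congrArg (TensorProduct.comm R F (R ⧸ Ideal.span {r})) hzero)
  rw [TensorProduct.comm_tmul, map_zero, map_zero,
    ← map_one (Ideal.Quotient.mk (Ideal.span {r})),
    TensorProduct.quotTensorEquivQuotSMul_mk_tmul, one_smul, Submodule.Quotient.mk_eq_zero,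
    Submodule.ideal_span_singleton_smul, Submodule.mem_smul_pointwise_iff_exists] at hq
  obtain ⟨f, -, hf⟩ := hq
  exact ⟨f, f.2, congrArg Subtype.val hf⟩

end RD

/-! ### Linear systems over RD-submodules -/

section Purity

variable {R : Type u} [CommRing R]

theorem IsLocallyComparable.exists_pivot (hR : IsLocallyComparable R) {P : Ideal R}
    (hP : P.IsMaximal) {α : Type*} (g : α → R) (S : Finset α) (hS : S.Nonempty) :
    ∃ p ∈ S, ∃ s ∉ P, ∀ x ∈ S, g p ∣ s * g x := by
  classical
  have hprime := hP.isPrime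
  induction hS using Finset.Nonempty.cons_induction with
  | singleton a =>
    exact ⟨a, by simp, 1, fun h => hP.ne_top ((Ideal.eq_top_iff_one _).2 h), by simp⟩
  | cons a S ha hS ih =>
    obtain ⟨p, hp, s, hs, hdiv⟩ := ih
    obtain ⟨t, ht, h | h⟩ := hR P hP (g a) (g p)
    · refine ⟨p, by simp [hp], s * t, fun h => (hprime.mem_or_mem h).elim hs ht, ?_⟩
      intro x hx
      rcases Finset.mem_cons.1 hx with rfl | hx
      · rw [mul_assoc]; exact h.mul_left s
      · rw [mul_right_comm]; exact (hdiv x hx).mul_right t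
    · refine ⟨a, by simp, t * s, fun h => (hprime.mem_or_mem h).elim ht hs, ?_⟩
      intro x hx
      rcases Finset.mem_cons.1 hx with rfl | hx
      · exact Dvd.intro_left _ rfl
      · rw [mul_assoc]; exact h.trans (mul_dvd_mul_left t (hdiv x hx))

variable {E : Type u} [AddCommGroup E] [Module R E]

/-- Locally at a maximal ideal, a linear system over an RD-submodule that is solvable in the
ambient module is solvable in the submodule. -/
theorem IsRDSubmodule.exists_local_solution (hR : IsLocallyComparable R) {F : Submodule R E}
    (hF : IsRDSubmodule F) {P : Ideal R} (hP : P.IsMaximal) {ι κ : Type*} (n : ℕ) :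
    ∀ (J : Finset κ), J.card = n → ∀ (I : Finset ι) (a : ι → κ → R) (f : ι → E) (y : κ → E),
      (∀ i ∈ I, f i ∈ F) → (∀ i ∈ I, f i = ∑ j ∈ J, a i j • y j) →
      ∃ s ∉ P, ∃ z : κ → E, (∀ j, z j ∈ F) ∧ ∀ i ∈ I, s • f i = ∑ j ∈ J, a i j • z j := by
  classical
  have hprime := hP.isPrime
  have hone : (1 : R) ∉ P := fun h => hP.ne_top ((Ideal.eq_top_iff_one _).2 h)
  rw [isRDSubmodule_iff] at hF
  induction n with
  | zero =>
    intro J hJ I a f y hf hy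
    rw [Finset.card_eq_zero] at hJ
    subst hJ
    exact ⟨1, hone, 0, fun _ => F.zero_mem, fun i hi => by simp [hy i hi]⟩
  | succ n ih =>
    intro J hJ I a f y hf hy
    rcases I.eq_empty_or_nonempty with rfl | hI
    · exact ⟨1, hone, 0, fun _ => F.zero_mem, by simp⟩
    have hJne : J.Nonempty := by rw [← Finset.card_pos]; omega
    obtain ⟨⟨p, q⟩, hpq, s, hs, hdiv⟩ := hR.exists_pivot hP (fun x : ι × κ => a x.1 x.2)
      (I ×ˢ J) (hI.product hJne)
    obtain ⟨hp, hq⟩ : p ∈ I ∧ q ∈ J := Finset.mem_product.1 hpq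
    have hdiv' : ∀ i j, ∃ c, i ∈ I → j ∈ J → s * a i j = a p q * c := by
      intro i j
      by_cases h : i ∈ I ∧ j ∈ J
      · obtain ⟨c, hc⟩ := hdiv (i, j) (Finset.mem_product.2 h)
        exact ⟨c, fun _ _ => hc⟩
      · exact ⟨0, fun h₁ h₂ => absurd ⟨h₁, h₂⟩ h⟩
    choose c hc using hdiv'
    have hsp : s • f p = a p q • ∑ j ∈ J, c p j • y j := by
      rw [hy p hp, Finset.smul_sum, Finset.smul_sum]
      refine Finset.sum_congr rfl fun j hj => ?_
      rw [smul_smul, smul_smul, hc p j hp hj]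
    -- Row `p`, scaled by `s`, is a multiple of the pivot, so relative divisibility applies to it as
    -- to one equation in one unknown.
    obtain ⟨z, hz, hzp⟩ := hF (a p q) (∑ j ∈ J, c p j • y j)
      (hsp ▸ F.smul_mem s (hf p hp))
    rw [← hsp] at hzp
    -- Subtracting `c i q` times row `p` from `s` times row `i` eliminates the unknown `q`.
    obtain ⟨t, ht, w, hw, hwf⟩ := ih (J.erase q) (by rw [Finset.card_erase_of_mem hq]; omega) I
      (fun i j => s * a i j - c i q * a p j) (fun i => s • f i - c i q • f p) y
      (fun i hi => F.sub_mem (F.smul_mem _ (hf i hi)) (F.smul_mem _ (hf p hp)))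
      (fun i hi => by
        have : ∑ j ∈ J, (s * a i j - c i q * a p j) • y j = s • f i - c i q • f p := by
          rw [hy i hi, hy p hp, Finset.smul_sum, Finset.smul_sum, ← Finset.sum_sub_distrib]
          exact Finset.sum_congr rfl fun j _ => by rw [sub_smul, mul_smul, mul_smul]
        rw [← this, ← Finset.add_sum_erase J _ hq, hc i q hi hq, mul_comm (a p q), sub_self,
          zero_smul, zero_add])
    set v : E := ∑ j ∈ J.erase q, a p j • w j with hv
    -- Back-substitution for the unknown `q`. The pivot divides the other entries only after scaling
    -- by `s`, which costs the extra factors of `s` in the final solution.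
    set u : E := t • z - ∑ j ∈ J.erase q, c p j • w j with hu
    have hapu : a p q • u = (s * t) • f p - s • v := by
      rw [hu, hv, smul_sub, smul_comm, hzp, smul_smul, mul_comm t s, Finset.smul_sum,
        Finset.smul_sum]
      congr 1
      refine Finset.sum_congr rfl fun j hj => ?_
      rw [smul_smul, smul_smul, hc p j hp (Finset.mem_of_mem_erase hj)]
    refine ⟨s * (t * s), fun h => (hprime.mem_or_mem h).elim hs fun h =>
      (hprime.mem_or_mem h).elim ht hs, fun j => if j = q then s • u else s • s • w j, ?_, ?_⟩
    · intro j
      have hu' : u ∈ F := F.sub_mem (F.smul_mem _ hz)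
        (F.sum_mem fun j _ => F.smul_mem _ (hw j))
      dsimp only
      split_ifs
      · exact F.smul_mem _ hu'
      · exact F.smul_mem _ (F.smul_mem _ (hw j))
    · intro i hi
      rw [← Finset.add_sum_erase J _ hq]
      dsimp only
      rw [if_pos rfl]
      have h₁ : ∑ j ∈ J.erase q, a i j • (if j = q then s • u else s • s • w j) =
          s • ∑ j ∈ J.erase q, (s * a i j) • w j := by
        rw [Finset.smul_sum]
        refine Finset.sum_congr rfl fun j hj => ?_
        rw [if_neg (Finset.ne_of_mem_erase hj)]
        module
      have h₂ : ∑ j ∈ J.erase q, (s * a i j) • w j =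
          t • (s • f i - c i q • f p) + c i q • v := by
        rw [hwf i hi, hv, Finset.smul_sum, ← Finset.sum_add_distrib]
        refine Finset.sum_congr rfl fun j _ => ?_
        module
      have h₃ : a i q • s • u = c i q • a p q • u := by
        rw [smul_smul, smul_smul, mul_comm (a i q), hc i q hi hq, mul_comm (c i q)]
      rw [h₁, h₂, h₃, hapu]
      module

/-- Over a locally comparable ring, a finite linear system over an RD-submodule that is solvable
in the ambient module is solvable in the submodule. -/
theorem IsRDSubmodule.exists_solution (hR : IsLocallyComparable R) {F : Submodule R E}
    (hF : IsRDSubmodule F) {ι κ : Type*} [Fintype ι] [Fintype κ] (a : ι → κ → R) (f : ι → F)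
    (y : κ → E) (hy : ∀ i, (f i : E) = ∑ j, a i j • y j) :
    ∃ z : κ → F, ∀ i, f i = ∑ j, a i j • z j := by
  let L : (κ → F) →ₗ[R] (ι → F) :=
    LinearMap.pi fun i => ∑ j, a i j • LinearMap.proj j
  have hL : ∀ z i, L z i = ∑ j, a i j • z j := fun z i => by simp [L]
  -- The multipliers that make the system solvable form an ideal; local solutions keep it out of
  -- every maximal ideal.
  let T : Ideal R := (LinearMap.range L).comap (LinearMap.toSpanSingleton R _ f)
  have hT : T = ⊤ := by
    by_contra hne
    obtain ⟨P, hP, hle⟩ := Ideal.exists_le_maximal T hne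
    obtain ⟨s, hs, z, hz, h⟩ := hF.exists_local_solution hR hP _ Finset.univ rfl
      (Finset.univ : Finset ι) a (fun i => (f i : E)) y (fun i _ => (f i).2) (fun i _ => hy i)
    refine hs (hle ⟨fun j => ⟨z j, hz j⟩, ?_⟩)
    ext i
    rw [hL]
    simpa using (h i (Finset.mem_univ i)).symm
  obtain ⟨z, hz⟩ : (1 : R) ∈ T := hT ▸ trivial
  refine ⟨z, fun i => ?_⟩
  rw [← hL, hz]
  simp

/-- By the equational criterion, vanishing of a tensor over `E` is solvability of a finite linear
system, which descends to `F`. -/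
theorem IsRDSubmodule.isPureSubmodule (hR : IsLocallyComparable R) {F : Submodule R E}
    (hF : IsRDSubmodule F) : IsPureSubmodule F := by
  intro N _ _
  refine ⟨?_, rTensor_exact N (LinearMap.exact_subtype_mkQ F) F.mkQ_surjective,
    LinearMap.rTensor_surjective N F.mkQ_surjective⟩
  rw [injective_iff_map_eq_zero]
  intro x hx
  obtain ⟨k, f, n, rfl⟩ := TensorProduct.exists_sum_tmul_eq x
  let N₀ : Submodule R N := Submodule.span R (Set.range n)
  have hn (i : Fin k) : n i ∈ N₀ := Submodule.subset_span ⟨i, rfl⟩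
  have hN₀ : N₀.FG := Submodule.fg_span (Set.finite_range n)
  obtain ⟨Q, hle, ⟨S, hS⟩, hQ0⟩ := TensorProduct.eq_zero_of_fg_of_subtype_eq_zero
    (N := E) hN₀ (t := ∑ i, (⟨n i, hn i⟩ : N₀) ⊗ₜ[R] (f i : E)) (by
      have := congrArg (TensorProduct.comm R E N) hx
      simpa using this)
  -- The criterion needs a family spanning `Q`, so generators of `Q` are adjoined with zero partners
  -- in `F`.
  let q : Fin k ⊕ S → Q := Sum.elim (fun i => ⟨n i, hle (hn i)⟩)
    (fun x => ⟨x, hS ▸ Submodule.subset_span x.2⟩)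
  let g : Fin k ⊕ S → F := Sum.elim f 0
  have hspan : Submodule.span R (Set.range q) = ⊤ := by
    apply Submodule.map_injective_of_injective Q.subtype_injective
    rw [Submodule.map_span, Submodule.map_top, Submodule.range_subtype]
    refine le_antisymm ?_ ?_
    · rw [Submodule.span_le]
      rintro _ ⟨x, -, rfl⟩
      exact x.2
    · conv_lhs => rw [← hS]
      refine Submodule.span_mono fun x hx => ⟨_, ⟨Sum.inr ⟨x, hx⟩, rfl⟩, rfl⟩
  have hzero : ∑ i, q i ⊗ₜ[R] (g i : E) = 0 := by
    rw [map_sum] at hQ0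
    simpa [q, g] using! hQ0
  obtain ⟨l, a, y, h₁, h₂⟩ := TensorProduct.vanishesTrivially_of_sum_tmul_eq_zero R hspan hzero
  obtain ⟨z, hz⟩ := hF.exists_solution hR a g y h₁
  have hfin : ∑ i, q i ⊗ₜ[R] g i = 0 :=
    TensorProduct.sum_tmul_eq_zero_of_vanishesTrivially R ⟨l, a, z, hz, h₂⟩
  have := congrArg (TensorProduct.comm R N F) (congrArg (LinearMap.rTensor F Q.subtype) hfin)
  simpa [q, g] using this

end Purity

/-! ### Localizations at maximal ideals -/

theorem IsLocallyComparable.isArithmeticRing {R : Type u} [CommRing R]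
    (hR : IsLocallyComparable R) : IsArithmeticRing R := by
  intro P hP A B
  by_contra! h
  obtain ⟨hAB, hBA⟩ := h
  obtain ⟨x, hxA, hxB⟩ := SetLike.not_le_iff_exists.1 hAB
  obtain ⟨y, hyB, hyA⟩ := SetLike.not_le_iff_exists.1 hBA
  obtain ⟨⟨a, s⟩, hx⟩ := IsLocalization.surj P.primeCompl x
  obtain ⟨⟨b, t⟩, hy⟩ := IsLocalization.surj P.primeCompl y
  have hu (v : P.primeCompl) : IsUnit (algebraMap R (Localization.AtPrime P) v) :=
    IsLocalization.map_units _ v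
  dsimp only at hx hy
  obtain ⟨r, hr, ⟨c, hc⟩ | ⟨c, hc⟩⟩ := hR P hP a b
  · apply hxB
    have hmem : x * (algebraMap R (Localization.AtPrime P) s * algebraMap R _ r) ∈ B := by
      rw [← mul_assoc, hx, ← map_mul, mul_comm a, hc, map_mul, ← hy, mul_assoc, mul_comm]
      exact B.smul_mem _ hyB
    exact (Ideal.mul_unit_mem_iff_mem B ((hu s).mul (hu ⟨r, hr⟩))).1 hmem
  · apply hyA
    have hmem : y * (algebraMap R (Localization.AtPrime P) t * algebraMap R _ r) ∈ A := by
      rw [← mul_assoc, hy, ← map_mul, mul_comm b, hc, map_mul, ← hx, mul_assoc, mul_comm]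
      exact A.smul_mem _ hxA
    exact (Ideal.mul_unit_mem_iff_mem A ((hu t).mul (hu ⟨r, hr⟩))).1 hmem

/-! ### Generators of the steps of a series -/

section Chain

variable {R : Type u} [CommRing R] {M : Type u} [AddCommGroup M] [Module R M]

theorem exists_eq_sup_span_of_isCyclicModule {A B : Submodule R M} (hle : A ≤ B)
    (h : IsCyclicModule R (↥B ⧸ A.submoduleOf B)) : ∃ y ∈ B, B = A ⊔ R ∙ y := by
  obtain ⟨x, hx⟩ := h
  obtain ⟨y, rfl⟩ := Submodule.mkQ_surjective _ x
  refine ⟨y, y.2, le_antisymm ?_ (sup_le hle ?_)⟩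
  · intro b hb
    have : (A.submoduleOf B).mkQ ⟨b, hb⟩ ∈ R ∙ ((A.submoduleOf B).mkQ y) := hx ▸ trivial
    obtain ⟨r, hr⟩ := Submodule.mem_span_singleton.1 this
    rw [← map_smul, ← sub_eq_zero, ← map_sub, Submodule.mkQ_apply,
      Submodule.Quotient.mk_eq_zero] at hr
    have hr' : r • (y : M) - b ∈ A := hr
    rw [show b = -(r • (y : M) - b) + r • (y : M) by abel]
    exact Submodule.add_mem_sup (A.neg_mem hr')
      (Submodule.smul_mem _ r (Submodule.mem_span_singleton_self _))
  · rw [Submodule.span_singleton_le_iff_mem]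
    exact y.2

/-- A cyclic series yields a generator of each step modulo the previous one. -/
theorem HasCyclicSeries.exists_generators {Q : Submodule R M → Prop} (h : HasCyclicSeries Q) :
    ∃ (n : ℕ) (c : Fin (n + 1) → Submodule R M), c 0 = ⊥ ∧ c (Fin.last n) = ⊤ ∧
      (∀ i, Q (c i)) ∧ ∀ i : Fin n, ∃ y : M, c i.succ = c i.castSucc ⊔ R ∙ y := by
  obtain ⟨n, c, hmono, h0, hlast, hQ, hcyc⟩ := h
  refine ⟨n, c, h0, hlast, hQ, fun i => ?_⟩
  obtain ⟨y, -, hy⟩ := exists_eq_sup_span_of_isCyclicModule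
    (hmono.monotone (Fin.castSucc_lt_succ).le) (hcyc i)
  exact ⟨y, hy⟩

theorem HasCyclicSeries.mono {Q Q' : Submodule R M → Prop} (hQ : ∀ F, Q F → Q' F)
    (h : HasCyclicSeries Q) : HasCyclicSeries Q' := by
  obtain ⟨n, c, hmono, h0, hlast, hc, hcyc⟩ := h
  exact ⟨n, c, hmono, h0, hlast, fun i => hQ _ (hc i), hcyc⟩

theorem mem_sup_span_singleton_iff {A : Submodule R M} {x y : M} :
    x ∈ A ⊔ R ∙ y ↔ ∃ r : R, x - r • y ∈ A := by
  rw [Submodule.mem_sup]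
  constructor
  · rintro ⟨z, hz, w, hw, rfl⟩
    obtain ⟨r, rfl⟩ := Submodule.mem_span_singleton.1 hw
    exact ⟨r, by simpa using hz⟩
  · rintro ⟨r, hr⟩
    exact ⟨_, hr, _, Submodule.smul_mem _ r (Submodule.mem_span_singleton_self y), by abel⟩

end Chain

/-! ### The RD series property forces local comparability -/

section Arithmetic

variable {R : Type u} [CommRing R]

/-- If every finitely generated module has an RD-composition series with cyclic factors, then any
two elements are locally comparable: otherwise, for incomparable `a` and `b`, the module
`R² / (R(a, b) + (Pa + Pb)R²)` has no RD-submodule whose quotient is cyclic and nonzero at `P`. -/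
theorem HasRDCyclicSeriesProperty.isLocallyComparable (h : HasRDCyclicSeriesProperty R) :
    IsLocallyComparable R := by
  intro P hP a b
  by_contra! hab
  have hprime := hP.isPrime
  have hmul {s t : R} (hs : s ∉ P) (ht : t ∉ P) : s * t ∉ P :=
    fun h => (hprime.mem_or_mem h).elim hs ht
  have ha : a ∈ P := by
    by_contra ha
    exact (hab a ha).2 (Dvd.intro _ rfl)
  have hb : b ∈ P := by
    by_contra hb
    exact (hab b hb).1 (Dvd.intro _ rfl)
  -- A coefficient outside `P` would make one of `a`, `b` divide a multiple of the other by an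
  -- element outside `P`.
  have hind : ∀ p q : R, p * a + q * b = 0 → p ∈ P ∧ q ∈ P := by
    intro p q hpq
    constructor <;> by_contra hn
    · exact (hab p hn).1 ⟨-q, by linear_combination hpq⟩
    · exact (hab q hn).2 ⟨-p, by linear_combination hpq⟩
  let J : Ideal R := P * Ideal.span {a, b}
  have hJ : ∀ x ∈ J, ∃ p ∈ P, ∃ q ∈ P, x = p * a + q * b := by
    intro x hx
    induction hx using Submodule.mul_induction_on' with
    | mem_mul_mem m hm n hn =>
      obtain ⟨c, d, rfl⟩ := Ideal.mem_span_pair.1 hn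
      exact ⟨m * c, P.mul_mem_right _ hm, m * d, P.mul_mem_right _ hm, by ring⟩
    | add x _ y _ hx hy =>
      obtain ⟨p, hp, q, hq, rfl⟩ := hx
      obtain ⟨p', hp', q', hq', rfl⟩ := hy
      exact ⟨p + p', P.add_mem hp hp', q + q', P.add_mem hq hq', by ring⟩
  let K : Submodule R (R × R) := (Submodule.prod J J) ⊔ R ∙ (a, b)
  have hK : ∀ x y : R, (x, y) ∈ K → ∃ t p q p' q', p ∈ P ∧ q ∈ P ∧ p' ∈ P ∧ q' ∈ P ∧
      x = t * a + (p * a + q * b) ∧ y = t * b + (p' * a + q' * b) := by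
    intro x y hxy
    obtain ⟨t, ht⟩ := mem_sup_span_singleton_iff.1 hxy
    obtain ⟨h₁, h₂⟩ := Submodule.mem_prod.1 ht
    obtain ⟨p, hp, q, hq, h₁⟩ := hJ _ h₁
    obtain ⟨p', hp', q', hq', h₂⟩ := hJ _ h₂
    simp only [Prod.fst_sub, Prod.smul_fst, Prod.snd_sub, Prod.smul_snd, smul_eq_mul] at h₁ h₂
    exact ⟨t, p, q, p', q', hp, hq, hp', hq', by linear_combination h₁, by linear_combination h₂⟩
  obtain ⟨n, c, h0, hlast, hRD, hgen⟩ :=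
    (h ((R × R) ⧸ K) inferInstance).exists_generators
  let e₁ : (R × R) ⧸ K := K.mkQ (1, 0)
  let e₂ : (R × R) ⧸ K := K.mkQ (0, 1)
  have he (x y : R) : K.mkQ (x, y) = x • e₁ + y • e₂ := by
    rw [← map_smul, ← map_smul, ← map_add]
    simp
  have hrel : a • e₁ + b • e₂ = 0 := by
    rw [← he, Submodule.mkQ_apply, Submodule.Quotient.mk_eq_zero]
    exact Submodule.mem_sup_right (Submodule.mem_span_singleton_self _)
  -- No submodule of the chain contains `s • e₁` and `s • e₂` for some `s` outside `P`.
  have hnot : ∀ i, ¬ ∃ s ∉ P, s • e₁ ∈ c i ∧ s • e₂ ∈ c i := by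
    intro i
    induction i using Fin.induction with
    | zero =>
      rintro ⟨s, hs, h₁, -⟩
      rw [h0, Submodule.mem_bot, ← map_smul, Submodule.mkQ_apply, Submodule.Quotient.mk_eq_zero]
        at h₁
      obtain ⟨t, p, q, p', q', hp, hq, hp', hq', h₁, h₂⟩ := hK _ _ h₁
      simp only [smul_eq_mul, mul_one] at h₁
      exact hs (h₁ ▸ P.add_mem (P.mul_mem_left _ ha)
        (P.add_mem (P.mul_mem_left _ ha) (P.mul_mem_left _ hb)))
    | succ i ih =>
      rintro ⟨s, hs, h₁, h₂⟩
      obtain ⟨z, hz⟩ := hgen i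
      rw [hz, mem_sup_span_singleton_iff] at h₁ h₂
      obtain ⟨α, hα⟩ := h₁
      obtain ⟨β, hβ⟩ := h₂
      set G := c i.castSucc with hG
      have hrz : (a * α + b * β) • z ∈ G := by
        have := G.add_mem (G.smul_mem (-a) hα) (G.smul_mem (-b) hβ)
        have hs0 : s • (a • e₁ + b • e₂) = 0 := by rw [hrel, smul_zero]
        convert this using 1
        linear_combination (norm := module) hs0
      obtain ⟨f, hf, hfz⟩ := isRDSubmodule_iff.1 (hRD i.castSucc) _ _ hrz
      obtain ⟨⟨x, y⟩, hxy⟩ := K.mkQ_surjective (z - f)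
      have hr0 : (a * α + b * β) • (x, y) ∈ K := by
        rw [← Submodule.Quotient.mk_eq_zero, ← Submodule.mkQ_apply, map_smul, hxy, smul_sub, hfz,
          sub_self]
      obtain ⟨t, p, q, p', q', hp, hq, hp', hq', h₁, h₂⟩ := hK _ _ hr0
      simp only [smul_eq_mul] at h₁ h₂
      -- Modulo `P`, the rank-one matrix of products of `α, β` with `x, y` equals `t` times the
      -- identity.
      obtain ⟨h₁₁, h₁₂⟩ := hind (α * x - t - p) (β * x - q) (by linear_combination h₁)
      obtain ⟨h₂₁, h₂₂⟩ := hind (α * y - p') (β * y - t - q') (by linear_combination h₂)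
      -- This element kills `z` modulo `G`; outside `P` it would push the situation down to `G`.
      have hst : s - (x * α + y * β) ∈ P := by
        by_contra hn
        apply ih
        have hmem : (s - (x * α + y * β)) • z ∈ G := by
          have := G.add_mem (G.add_mem (G.smul_mem s hf) (G.smul_mem x hα)) (G.smul_mem y hβ)
          have hz' : z = x • e₁ + y • e₂ + f := by rw [← he, hxy]; abel
          convert this using 1
          linear_combination (norm := module) s • hz'
        refine ⟨(s - (x * α + y * β)) * s, hmul hn hs, ?_, ?_⟩
        · have := G.add_mem (G.smul_mem (s - (x * α + y * β)) hα) (G.smul_mem α hmem)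
          convert this using 1
          module
        · have := G.add_mem (G.smul_mem (s - (x * α + y * β)) hβ) (G.smul_mem β hmem)
          convert this using 1
          module
      have h₁₁' : α * x - t ∈ P := by simpa using P.add_mem h₁₁ hp
      have h₁₂' : β * x ∈ P := by simpa using P.add_mem h₁₂ hq
      have h₂₂' : β * y - t ∈ P := by simpa using P.add_mem h₂₂ hq'
      -- The determinant of the rank-one matrix is zero, so `t ^ 2 ∈ P`. Its trace is then in `P`
      -- too, forcing `s ∈ P`.
      have ht : t ∈ P := by
        refine hprime.mem_of_pow_mem 2 ?_
        have := P.sub_mem (P.mul_mem_left (α * y) h₁₂')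
          (P.add_mem (P.mul_mem_left (β * y) h₁₁') (P.mul_mem_left t h₂₂'))
        convert this using 1
        ring
      refine hs ?_
      have := P.add_mem hst (P.add_mem (P.add_mem h₁₁' h₂₂') (P.mul_mem_left 2 ht))
      convert this using 1
      ring
  exact hnot (Fin.last n) ⟨1, fun h => hP.ne_top ((Ideal.eq_top_iff_one _).2 h), by simp [hlast]⟩

end Arithmetic

/-! ### Finitely generated ideals are principal -/

section Bezout

variable {R : Type u} [CommRing R]

theorem HasRDCyclicSeriesProperty.isPrincipal_of_fg (h : HasRDCyclicSeriesProperty R)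
    (I : Ideal R) (hI : I.FG) : ∃ a, I = Ideal.span {a} := by
  have hR := h.isLocallyComparable
  obtain ⟨n, c, h0, hlast, hRD, hgen⟩ := (h I (Module.Finite.iff_fg.2 hI)).exists_generators
  have key : ∀ i, ∃ x : I, c i = R ∙ x := by
    intro i
    induction i using Fin.induction with
    | zero => exact ⟨0, by simp [h0]⟩
    | succ i ih =>
      obtain ⟨x, hx⟩ := ih
      obtain ⟨y, hy⟩ := hgen i
      have hF := isRDSubmodule_iff.1 (hRD i.castSucc)
      rw [hx] at hy hF
      let A : Ideal R := (R ∙ x).comap (LinearMap.toSpanSingleton R I y)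
      let B : Ideal R := LinearMap.ker (LinearMap.toSpanSingleton R I x)
      have hA (r : R) : r ∈ A ↔ r • y ∈ R ∙ x := Iff.rfl
      have hB (r : R) : r ∈ B ↔ r • x = 0 := Iff.rfl
      -- Comparing `x` and `y` at a maximal ideal containing both would put `s` in that ideal.
      have hAB : A ⊔ B = ⊤ := by
        by_contra hne
        obtain ⟨P, hP, hle⟩ := Ideal.exists_le_maximal _ hne
        have hPA : A ≤ P := le_sup_left.trans hle
        have hPB : B ≤ P := le_sup_right.trans hle
        obtain ⟨s, hs, ⟨r, hr⟩ | ⟨r, hr⟩⟩ := hR P hP (x : R) (y : R)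
        · have hsx : s • x = r • y := Subtype.ext (by simp [hr, mul_comm])
          have hrA : r • y ∈ R ∙ x :=
            hsx ▸ Submodule.smul_mem _ s (Submodule.mem_span_singleton_self x)
          obtain ⟨f, hf, hfr⟩ := hF r y hrA
          obtain ⟨d, rfl⟩ := Submodule.mem_span_singleton.1 hf
          have : s - r * d ∈ P := hPB <| (hB _).2 <| by
            rw [sub_smul, hsx, mul_smul, hfr, sub_self]
          exact hs (by simpa using P.add_mem this (P.mul_mem_right d (hPA ((hA r).2 hrA))))
        · have hsy : s • y = r • x := Subtype.ext (by simp [hr, mul_comm])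
          exact hs (hPA ((hA s).2 (hsy ▸
            Submodule.smul_mem _ r (Submodule.mem_span_singleton_self x))))
      obtain ⟨j, hj, t, ht, hjt⟩ := Submodule.mem_sup.1 ((Ideal.eq_top_iff_one _).1 hAB)
      rw [hA] at hj
      rw [hB] at ht
      obtain ⟨d, hd⟩ := Submodule.mem_span_singleton.1 hj
      have hjx : j • x = x := by
        rw [show j = 1 - t by rw [← hjt]; ring, sub_smul, ht, one_smul, sub_zero]
      have hxz : j • (x + t • y) = x := by
        rw [smul_add, hjx, smul_comm, ← hd, smul_comm, ht, smul_zero, add_zero]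
      -- With `1 = j + t`, `j • y = d • x` and `t • x = 0`, multiplying by `j` recovers `x`, and
      -- then `y` follows.
      refine ⟨x + t • y, ?_⟩
      rw [hy]
      have hxm : x ∈ R ∙ (x + t • y) := Submodule.mem_span_singleton.2 ⟨j, hxz⟩
      refine le_antisymm (sup_le ?_ ?_) ?_
      · rwa [Submodule.span_singleton_le_iff_mem]
      · rw [Submodule.span_singleton_le_iff_mem]
        have hyd : y = (x + t • y) + (d - 1) • x := by
          rw [sub_smul, hd, one_smul]
          nth_rewrite 1 [← one_smul R y, ← hjt]
          module
        have hmem := Submodule.add_mem _ (Submodule.mem_span_singleton_self (x + t • y))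
          (Submodule.smul_mem _ (d - 1) hxm)
        rwa [← hyd] at hmem
      · rw [Submodule.span_singleton_le_iff_mem]
        exact Submodule.add_mem_sup (Submodule.mem_span_singleton_self _)
          (Submodule.smul_mem _ _ (Submodule.mem_span_singleton_self _))
  obtain ⟨x, hx⟩ := key (Fin.last n)
  rw [hlast] at hx
  refine ⟨x, ?_⟩
  have := congrArg (Submodule.map I.subtype) hx
  rwa [Submodule.map_top, Submodule.range_subtype, Submodule.map_span, Set.image_singleton] at this

end Bezout

/-! ### Splitting finitely presented modules -/

section Kaplansky

variable {R : Type u} [CommRing R]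

/-- Let `B = A + Ry` be finitely presented with `A` finitely generated and relatively divisible.
Over a ring whose finitely generated ideals are principal, `B` is the direct sum of `A` and a
cyclically presented module. -/
theorem exists_linearEquiv_prod_quotient (hB : ∀ I : Ideal R, I.FG → ∃ a, I = Ideal.span {a})
    {M : Type u} [AddCommGroup M] [Module R M] {A B : Submodule R M} (y : M)
    (hAB : B = A ⊔ R ∙ y) (hA : IsRDSubmodule A) (hfg : A.FG)
    [hfp : Module.FinitePresentation R B] :
    ∃ a : R, Nonempty (((R ⧸ Ideal.span {a}) × A) ≃ₗ[R] B) := by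
  have hle : A ≤ B := hAB ▸ le_sup_left
  have hyB : y ∈ B := hAB ▸ Submodule.mem_sup_right (Submodule.mem_span_singleton_self y)
  have hfpQ : Module.FinitePresentation R (B ⧸ A.submoduleOf B) := by
    refine Module.finitePresentation_of_surjective _ (A.submoduleOf B).mkQ_surjective ?_
    rw [Submodule.ker_mkQ]
    have : Module.Finite R A := Module.Finite.iff_fg.2 hfg
    have : Module.Finite R (A.submoduleOf B) :=
      Module.Finite.equiv (Submodule.submoduleOfEquivOfLe hle).symm
    exact Module.Finite.iff_fg.1 this
  let φ : R →ₗ[R] (B ⧸ A.submoduleOf B) :=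
    (A.submoduleOf B).mkQ ∘ₗ LinearMap.toSpanSingleton R B ⟨y, hyB⟩
  have hφ : Function.Surjective φ := by
    intro q
    obtain ⟨⟨b, hb⟩, rfl⟩ := Submodule.mkQ_surjective _ q
    obtain ⟨r, hr⟩ := mem_sup_span_singleton_iff.1 (hAB ▸ hb)
    refine ⟨r, ?_⟩
    rw [LinearMap.comp_apply, ← sub_eq_zero, ← map_sub, Submodule.mkQ_apply,
      Submodule.Quotient.mk_eq_zero, ← neg_mem_iff, neg_sub]
    exact hr
  have hker (r : R) : r ∈ LinearMap.ker φ ↔ r • y ∈ A := by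
    rw [LinearMap.mem_ker, LinearMap.comp_apply, Submodule.mkQ_apply,
      Submodule.Quotient.mk_eq_zero]
    exact Iff.rfl
  obtain ⟨a, ha⟩ := hB (LinearMap.ker φ) (Module.FinitePresentation.fg_ker φ hφ)
  obtain ⟨f, hf, hfa⟩ := isRDSubmodule_iff.1 hA a y
    ((hker a).1 (ha ▸ Ideal.mem_span_singleton_self a))
  -- Another lift of the generator, now annihilated by `a`: this splits off the quotient.
  let z : B := ⟨y - f, B.sub_mem hyB (hle hf)⟩
  have haz : a • z = 0 := Subtype.ext (by simp [z, smul_sub, hfa])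
  let ψ : (R ⧸ Ideal.span {a}) →ₗ[R] B :=
    (Ideal.span {a}).liftQ (LinearMap.toSpanSingleton R B z) (by
      rw [Ideal.span, Submodule.span_singleton_le_iff_mem]
      exact haz)
  have hψ (r : R) : ψ (Ideal.Quotient.mk _ r) = r • z := rfl
  refine ⟨a, ⟨LinearEquiv.ofBijective (ψ.coprod (Submodule.inclusion hle)) ⟨?_, ?_⟩⟩⟩
  · rw [injective_iff_map_eq_zero]
    rintro ⟨q, x⟩ h
    obtain ⟨r, rfl⟩ := Ideal.Quotient.mk_surjective q
    rw [LinearMap.coprod_apply, hψ] at h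
    have h' : r • (y - f) + (x : M) = 0 := congrArg Subtype.val h
    have hr : r ∈ Ideal.span {a} := by
      rw [← ha, hker]
      have : r • y = r • f - x := by rw [smul_sub] at h'; linear_combination (norm := module) h'
      rw [this]
      exact A.sub_mem (A.smul_mem _ hf) x.2
    obtain ⟨d, rfl⟩ := Ideal.mem_span_singleton.1 hr
    have hx : (x : M) = 0 := by
      rwa [mul_comm, mul_smul, smul_sub, hfa, sub_self, smul_zero, zero_add] at h'
    exact Prod.ext (Ideal.Quotient.eq_zero_iff_mem.2 hr) (Subtype.ext hx)
  · rintro ⟨b, hb⟩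
    obtain ⟨r, hr⟩ := mem_sup_span_singleton_iff.1 (hAB ▸ hb)
    refine ⟨(Ideal.Quotient.mk _ r, ⟨b - r • y + r • f, A.add_mem hr (A.smul_mem _ hf)⟩), ?_⟩
    rw [LinearMap.coprod_apply, hψ]
    apply Subtype.ext
    change r • (y - f) + (b - r • y + r • f) = b
    module

theorem HasRDCyclicSeriesProperty.isKaplanskyRing (h : HasRDCyclicSeriesProperty R) :
    IsKaplanskyRing R := by
  intro M _ _ hM
  obtain ⟨n, c, h0, hlast, hRD, hgen⟩ := (h M inferInstance).exists_generators
  have hfg : ∀ i, (c i).FG := by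
    intro i
    induction i using Fin.induction with
    | zero => exact h0 ▸ Submodule.fg_bot
    | succ i ih =>
      obtain ⟨y, hy⟩ := hgen i
      exact hy ▸ ih.sup (Submodule.fg_span_singleton y)
  -- Finite presentation is a hypothesis here because it descends: each term is a direct summand of
  -- the next.
  have key : ∀ i, Module.FinitePresentation R (c i) →
      ∃ (n : ℕ) (a : Fin n → R), Nonempty (c i ≃ₗ[R] ((i : Fin n) → R ⧸ Ideal.span {a i})) := by
    intro i
    induction i using Fin.induction with
    | zero =>
      intro _
      have : Subsingleton (c 0) := by rw [h0]; infer_instance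
      exact ⟨0, Fin.elim0, ⟨0, 0, fun _ => Subsingleton.elim _ _, fun _ => Subsingleton.elim _ _⟩⟩
    | succ i ih =>
      intro hfp
      obtain ⟨y, hy⟩ := hgen i
      obtain ⟨a, ⟨e⟩⟩ := exists_linearEquiv_prod_quotient h.isPrincipal_of_fg y hy
        (hRD i.castSucc) (hfg i.castSucc)
      have hfp' : Module.FinitePresentation R ((R ⧸ Ideal.span {a}) × c i.castSucc) :=
        .of_equiv e.symm
      obtain ⟨m, b, ⟨e'⟩⟩ := ih <|
        Module.finitePresentation_of_split_exact
          (LinearMap.inr R (R ⧸ Ideal.span {a}) (c i.castSucc)) (LinearMap.fst R _ _)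
          (LinearMap.inl R _ _) (LinearMap.fst_comp_inl _ _ _) LinearMap.inr_injective
          .inr_fst
      refine ⟨m + 1, Fin.cons a b, ⟨e.symm ≪≫ₗ (LinearEquiv.prodCongr (.refl R _) e') ≪≫ₗ
        Fin.consLinearEquiv R
          (fun i : Fin (m + 1) => R ⧸ Ideal.span {(Fin.cons a b : Fin (m + 1) → R) i})⟩⟩
  have e : c (Fin.last n) ≃ₗ[R] M := (LinearEquiv.ofEq _ _ hlast).trans Submodule.topEquiv
  obtain ⟨m, a, ⟨e'⟩⟩ := key (Fin.last n) (.of_equiv e.symm)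
  exact ⟨m, a, ⟨e.symm ≪≫ₗ e'⟩⟩

end Kaplansky

theorem mainTheorem5 (R : Type u) [CommRing R] :
    (HasPureCyclicSeriesProperty R ↔ HasRDCyclicSeriesProperty R) ∧
    (HasPureCyclicSeriesProperty R ∨ HasRDCyclicSeriesProperty R →
      IsArithmeticRing R ∧ IsKaplanskyRing R) := by
  have hiff : HasPureCyclicSeriesProperty R ↔ HasRDCyclicSeriesProperty R :=
    ⟨fun h M _ _ hM => (h M hM).mono fun _ hF => hF.isRDSubmodule,
      fun h M _ _ hM => (h M hM).mono fun _ hF => hF.isPureSubmodule h.isLocallyComparable⟩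
  refine ⟨hiff, fun h => ?_⟩
  have hRD : HasRDCyclicSeriesProperty R := h.elim hiff.1 id
  exact ⟨hRD.isLocallyComparable.isArithmeticRing, hRD.isKaplanskyRing⟩
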